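/- Let $G$ be a finite, simple, connected graph with vertex set $V(G)$, order $n(G)=|V(G)|$, clique number $\omega(G)$ (the largest number of vertices of a clique in $G$), and shortest-path distance $d_G$. A set $S\subseteq V(G)$ is a *local resolving set* of $G$ if for any two adjacent vertices $u,v\in V(G)\setminus S$ there is a vertex $w\in S$ with $d_G(u,w)\neq d_G(v,w)$. The *local metric dimension* $\dim_l(G)$ is the smallest cardinality of a local resolving set of $G$. If $n(G)\geq\omega(G)+1\geq 4$, then $$\dim_l(G)\leq\left\lfloor\left(\frac{\omega(G)-2}{\omega(G)-1}\right)n(G)\right\rfloor .$$ -/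

import Mathlib

namespace SimpleGraph

variable {V : Type*}

/-- The vertex `w` distinguishes `u` and `v` in `G`: the distances to `w` from `u` and `v` differ. -/
def Distinguishes (G : SimpleGraph V) (w u v : V) : Prop :=
  G.dist u w ≠ G.dist v w

/-- `S` is a local resolving set of `G`: any two adjacent vertices outside `S` are
distinguished by a vertex of `S`. -/
def IsLocalResolvingSet (G : SimpleGraph V) (S : Finset V) : Prop :=
  ∀ u v : V, u ∉ S → v ∉ S → G.Adj u v → ∃ w ∈ S, G.Distinguishes w u v

/-- The local metric dimension of a finite graph: the smallest cardinality of a local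
resolving set. -/
noncomputable def localMetricDim [Fintype V] (G : SimpleGraph V) : ℕ :=
  sInf {k : ℕ | ∃ S : Finset V, G.IsLocalResolvingSet S ∧ S.card = k}

/-- The minimum defining the local metric dimension is attained. -/
theorem exists_isLocalResolvingSet_card_eq [Fintype V] (G : SimpleGraph V) :
    ∃ S : Finset V, G.IsLocalResolvingSet S ∧ S.card = G.localMetricDim :=
  Nat.sInf_mem (s := {k : ℕ | ∃ S : Finset V, G.IsLocalResolvingSet S ∧ S.card = k})
    ⟨_, Finset.univ, fun u _ hu => absurd (Finset.mem_univ u) hu, rfl⟩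

end SimpleGraph

namespace SimpleGraph

variable {V : Type*} [DecidableEq V]

/-! Put k = ω − 1. It suffices to find T with at least n/k vertices whose adjacent pairs are
separated by adjacency to a vertex outside T, since the complement of T is then local resolving.
`hasLargeAdjResolved_of_cliqueFree` does this by strong induction for every vertex set W such that
no component of G[W] is a (k+1)-clique; such a component could give T only one of its k+1 vertices.
Connectivity and n > ω exclude it in G itself.

If W contains no (k+1)-clique, a maximum T is large enough by counting
(`hasLargeAdjResolved_of_forall_not_isNClique`). Otherwise such a clique yields a robust pair (P, Z)
with |P| = 2 and |Z| = k: P joins T, Z stays outside, and induction handles the rest. Deleting P ∪ Z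
may create (k+1)-clique components. Those touching Z are absorbed into the pair without spoiling the
ratio (`IsRobustPair.exists_union_isCliqueComponent`). One not touching Z hangs off the two vertices
of P, and a better pair is then built near it. -/

/-- `T ⊆ W`, and any two adjacent vertices of `T` are told apart by their adjacency to some
vertex of `W \ T`. -/
def IsAdjResolved (G : SimpleGraph V) (W T : Finset V) : Prop :=
  T ⊆ W ∧ ∀ u ∈ T, ∀ v ∈ T, G.Adj u v → ∃ w ∈ W \ T, ¬(G.Adj w u ↔ G.Adj w v)

/-- `W` contains an adjacency-resolved subset comprising at least a `1 / k` fraction of `W`. -/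
def HasLargeAdjResolved (G : SimpleGraph V) (k : ℕ) (W : Finset V) : Prop :=
  ∃ T, G.IsAdjResolved W T ∧ W.card ≤ k * T.card

/-- `L` is a clique with `m` vertices and a connected component of the subgraph induced by `W`. -/
def IsCliqueComponent (G : SimpleGraph V) (m : ℕ) (W L : Finset V) : Prop :=
  L ⊆ W ∧ G.IsNClique m L ∧ ∀ a ∈ L, ∀ b ∈ W, b ∉ L → ¬G.Adj a b

/-- Every vertex of `P` is told apart, through adjacency to `Z`, from each of its neighbours in
`W \ Z`. -/
def IsRobustPair (G : SimpleGraph V) (W P Z : Finset V) : Prop :=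
  P ⊆ W ∧ Z ⊆ W ∧ Disjoint P Z ∧
    ∀ p ∈ P, ∀ w ∈ W, w ∉ Z → G.Adj p w → ∃ z ∈ Z, ¬(G.Adj z p ↔ G.Adj z w)

variable {G : SimpleGraph V} {k : ℕ} {W P Z L : Finset V}

theorem exists_adj_of_not_isCliqueComponent {m : ℕ} (hW : ∀ L, ¬G.IsCliqueComponent m W L)
    (hL : L ⊆ W) (hc : G.IsNClique m L) : ∃ a ∈ L, ∃ b ∈ W, b ∉ L ∧ G.Adj a b := by
  by_contra! h
  exact hW L ⟨hL, hc, h⟩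

theorem exists_not_adj_of_cliqueFree (hG : G.CliqueFree (k + 2)) (hL : G.IsNClique (k + 1) L)
    (u : V) : ∃ b ∈ L, ¬G.Adj u b := by
  by_contra! h
  exact hG _ (hL.insert h)

/-! ### Robust pairs and absorption of clique components -/

theorem IsRobustPair.isAdjResolved_union {T : Finset V} (h : G.IsRobustPair W P Z)
    (hT : G.IsAdjResolved (W \ (P ∪ Z)) T) : G.IsAdjResolved W (T ∪ P) := by
  obtain ⟨hP, hZ, hPZ, hr⟩ := h
  obtain ⟨hTW, hT⟩ := hT
  have hTmem : ∀ x ∈ T, x ∈ W ∧ x ∉ P ∧ x ∉ Z := by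
    intro x hx
    have := hTW hx
    simpa [not_or] using this
  have hmem : ∀ x ∈ T ∪ P, x ∈ W ∧ x ∉ Z := by
    intro x hx
    rcases Finset.mem_union.1 hx with hx | hx
    · exact ⟨(hTmem x hx).1, (hTmem x hx).2.2⟩
    · exact ⟨hP hx, Finset.disjoint_left.1 hPZ hx⟩
  have hZmem : ∀ z ∈ Z, z ∈ W \ (T ∪ P) := by
    intro z hz
    rw [Finset.mem_sdiff]
    exact ⟨hZ hz, fun h => (hmem z h).2 hz⟩
  refine ⟨fun x hx => (hmem x hx).1, fun u hu v hv huv => ?_⟩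
  by_cases huP : u ∈ P
  · obtain ⟨z, hz, hne⟩ := hr u huP v (hmem v hv).1 (hmem v hv).2 huv
    exact ⟨z, hZmem z hz, hne⟩
  by_cases hvP : v ∈ P
  · obtain ⟨z, hz, hne⟩ := hr v hvP u (hmem u hu).1 (hmem u hu).2 huv.symm
    exact ⟨z, hZmem z hz, fun h => hne h.symm⟩
  have huT : u ∈ T := (Finset.mem_union.1 hu).resolve_right huP
  have hvT : v ∈ T := (Finset.mem_union.1 hv).resolve_right hvP
  obtain ⟨w, hw, hne⟩ := hT u huT v hvT huv
  simp only [Finset.mem_sdiff, Finset.mem_union, not_or] at hw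
  exact ⟨w, by simp [hw], hne⟩

/-- Some z in Z is adjacent to a vertex l of L, and not to all of L since there is no (k+2)-clique;
so z separates l from some l'. Put l, l' in P and the rest of L in Z. Any other neighbour of l or l'
outside the new Z lies in P, which is already robust. The ratio survives because k + 1 ≤ 2k. -/
theorem IsRobustPair.exists_union_isCliqueComponent (hG : G.CliqueFree (k + 2))
    (h : G.IsRobustPair W P Z) (hL : G.IsCliqueComponent (k + 1) (W \ (P ∪ Z)) L)
    (hadj : ∃ l ∈ L, ∃ z ∈ Z, G.Adj l z) :
    ∃ P' Z', G.IsRobustPair W P' Z' ∧ Z ⊆ Z' ∧ P' ∪ Z' = P ∪ Z ∪ L ∧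
      P'.card = P.card + 2 ∧ Z'.card + 1 = Z.card + k := by
  obtain ⟨l, hl, z, hz, hlz⟩ := hadj
  obtain ⟨l', hl', hzl'⟩ := exists_not_adj_of_cliqueFree hG hL.2.1 z
  obtain ⟨hP, hZ, hPZ, hr⟩ := h
  obtain ⟨hLW, hLc, hLout⟩ := hL
  have hne : l ≠ l' := by rintro rfl; exact hzl' hlz.symm
  have hLmem : ∀ x ∈ L, x ∈ W ∧ x ∉ P ∧ x ∉ Z := by
    intro x hx
    have := hLW hx
    simpa [not_or] using this
  have hpair : ({l, l'} : Finset V) ⊆ L := by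
    intro x hx
    rcases Finset.mem_insert.1 hx with rfl | hx
    · exact hl
    · rwa [Finset.mem_singleton.1 hx]
  have hdP : Disjoint P {l, l'} :=
    Finset.disjoint_right.2 fun x hx => (hLmem x (hpair hx)).2.1
  have hdZ : Disjoint Z (L \ {l, l'}) :=
    Finset.disjoint_right.2 fun x hx => (hLmem x (Finset.sdiff_subset hx)).2.2
  have hc2 : ({l, l'} : Finset V).card = 2 := Finset.card_pair hne
  refine ⟨P ∪ {l, l'}, Z ∪ (L \ {l, l'}), ⟨?_, ?_, ?_, ?_⟩, Finset.subset_union_left, ?_, ?_, ?_⟩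
  · exact Finset.union_subset hP fun x hx => (hLmem x (hpair hx)).1
  · exact Finset.union_subset hZ fun x hx => (hLmem x (Finset.sdiff_subset hx)).1
  · rw [Finset.disjoint_union_left, Finset.disjoint_union_right, Finset.disjoint_union_right]
    exact ⟨⟨hPZ, Finset.disjoint_right.2 fun x hx => (hLmem x (Finset.sdiff_subset hx)).2.1⟩,
      Finset.disjoint_left.2 fun x hx => (hLmem x (hpair hx)).2.2, Finset.disjoint_sdiff⟩
  · intro p hp w hw hwZ hpw
    have hwZ' : w ∉ Z := fun h => hwZ (Finset.mem_union_left _ h)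
    rcases Finset.mem_union.1 hp with hpP | hpl
    · obtain ⟨y, hy, hne⟩ := hr p hpP w hw hwZ' hpw
      exact ⟨y, Finset.mem_union_left _ hy, hne⟩
    by_cases hwP : w ∈ P
    · obtain ⟨y, hy, hne⟩ := hr w hwP p (hLmem p (hpair hpl)).1 (hLmem p (hpair hpl)).2.2 hpw.symm
      exact ⟨y, Finset.mem_union_left _ hy, fun h => hne h.symm⟩
    have hwL : w ∈ L := by
      by_contra hwL
      exact hLout p (hpair hpl) w (by simp [hw, hwP, hwZ']) hwL hpw
    have hwl : w ∈ ({l, l'} : Finset V) := by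
      by_contra hwl
      exact hwZ (Finset.mem_union_right _ (Finset.mem_sdiff.2 ⟨hwL, hwl⟩))
    refine ⟨z, Finset.mem_union_left _ hz, ?_⟩
    have hpw' := hpw.ne
    simp only [Finset.mem_insert, Finset.mem_singleton] at hpl hwl
    rcases hpl with rfl | rfl <;> rcases hwl with rfl | rfl
    · exact absurd rfl hpw'
    · exact fun h => hzl' (h.1 hlz.symm)
    · exact fun h => hzl' (h.2 hlz.symm)
    · exact absurd rfl hpw'
  · rw [Finset.union_union_union_comm, Finset.union_sdiff_of_subset hpair]
  · rw [Finset.card_union_of_disjoint hdP, hc2]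
  · rw [Finset.card_union_of_disjoint hdZ, Finset.card_sdiff_of_subset hpair, hc2, hLc.card_eq]
    have : 2 ≤ k + 1 := by
      rw [← hLc.card_eq, ← hc2]; exact Finset.card_le_card hpair
    omega

/-- Absorb clique components until none remains, then apply the induction hypothesis to what is
left. -/
theorem IsRobustPair.hasLargeAdjResolved (hG : G.CliqueFree (k + 2))
    (IH : ∀ W' ⊂ W, (∀ L, ¬G.IsCliqueComponent (k + 1) W' L) → G.HasLargeAdjResolved k W')
    (h : G.IsRobustPair W P Z) (hne : P.Nonempty) (hcard : Z.card + P.card ≤ k * P.card)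
    (hadj : ∀ L, G.IsCliqueComponent (k + 1) (W \ (P ∪ Z)) L → ∃ l ∈ L, ∃ z ∈ Z, G.Adj l z) :
    G.HasLargeAdjResolved k W := by
  induction hn : (W \ (P ∪ Z)).card using Nat.strong_induction_on generalizing P Z with
  | _ n ih =>
    by_cases hL : ∃ L, G.IsCliqueComponent (k + 1) (W \ (P ∪ Z)) L
    · obtain ⟨L, hL⟩ := hL
      obtain ⟨P', Z', h', hZZ, hU, hP', hZ'⟩ :=
        h.exists_union_isCliqueComponent hG hL (hadj L hL)
      have hW : W \ (P' ∪ Z') = (W \ (P ∪ Z)) \ L := by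
        rw [hU, sdiff_sdiff_left, Finset.sup_eq_union]
      have hlt : (W \ (P' ∪ Z')).card < n := by
        rw [hW, ← hn]
        refine Finset.card_lt_card (Finset.sdiff_ssubset hL.1 ?_)
        rw [← Finset.card_pos, hL.2.1.card_eq]; omega
      refine ih _ hlt h' ?_ ?_ ?_ rfl
      · rw [← Finset.card_pos]; omega
      · rw [hP']; nlinarith [hL.2.1.card_eq]
      · intro M hM
        rw [hW] at hM
        -- As L is a component, deleting it creates no new component: M was one before and so
        -- already touches Z.
        obtain ⟨l, hl, z, hz, hlz⟩ := hadj M ⟨hM.1.trans Finset.sdiff_subset, hM.2.1, by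
          intro a ha b hb hbM hab
          by_cases hbL : b ∈ L
          · have := Finset.mem_sdiff.1 (hM.1 ha)
            exact hL.2.2 b hbL a this.1 this.2 hab.symm
          · exact hM.2.2 a ha b (Finset.mem_sdiff.2 ⟨hb, hbL⟩) hbM hab⟩
        exact ⟨l, hl, z, hZZ hz, hlz⟩
    · have hsub : P ∪ Z ⊆ W := Finset.union_subset h.1 h.2.1
      obtain ⟨T, hT, hTc⟩ := IH (W \ (P ∪ Z))
        (Finset.sdiff_ssubset hsub (hne.mono Finset.subset_union_left)) (not_exists.1 hL)
      refine ⟨T ∪ P, h.isAdjResolved_union hT, ?_⟩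
      have hd : Disjoint T P := Finset.disjoint_left.2 fun x hx hxP => by
        have := hT.1 hx
        simp [hxP] at this
      have h1 := Finset.card_sdiff_add_card_eq_card hsub
      rw [Finset.card_union_of_disjoint h.2.2.1] at h1
      rw [Finset.card_union_of_disjoint hd]
      nlinarith

/-! ### Vertex sets without (k+1)-cliques -/

/-- If each vertex of `D ⊆ S` is the only vertex of `S` telling apart some pair in `T`, then
merging these pairs loses at least `D.card` classes, and the neighbourhoods in `S` of vertices of
the same class differ only inside `D`. -/
theorem exists_merge_of_unique_separators (G : SimpleGraph V) {S T D : Finset V} (hDS : D ⊆ S)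
    (h : ∀ s ∈ D, ∃ a ∈ T, ∃ b ∈ T, ¬(G.Adj s a ↔ G.Adj s b) ∧
      ∀ x ∈ S, x ≠ s → (G.Adj x a ↔ G.Adj x b)) :
    ∃ κ : V → V, (∀ u ∈ T, ∀ v ∈ T, κ u = κ v → ∀ x ∈ S, x ∉ D → (G.Adj x u ↔ G.Adj x v)) ∧
      D.card + (T.image κ).card ≤ T.card := by
  induction D using Finset.induction_on with
  | empty =>
    refine ⟨id, fun u _ v _ huv x _ _ => ?_, by simp⟩
    rw [show u = v from huv]
  | insert s D hs ih =>
    obtain ⟨κ, hκ, hc⟩ := ih ((Finset.subset_insert _ _).trans hDS)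
      fun t ht => h t (Finset.mem_insert_of_mem ht)
    obtain ⟨a, ha, b, hb, hne, hab⟩ := h s (Finset.mem_insert_self _ _)
    -- Classes built so far agree on adjacency to s, as s ∉ D, whereas s separates a from b.
    have hκab : κ a ≠ κ b := fun he => hne (hκ a ha b hb he s (hDS (Finset.mem_insert_self _ _)) hs)
    refine ⟨fun u => if κ u = κ a then κ b else κ u, ?_, ?_⟩
    · intro u hu v hv huv x hx hxD
      rw [Finset.mem_insert, not_or] at hxD
      have hxab := hab x hx hxD.1
      simp only at huv
      split_ifs at huv with h1 h2 h2
      · exact hκ u hu v hv (h1.trans h2.symm) x hx hxD.2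
      · exact (hκ u hu a ha h1 x hx hxD.2).trans
          (hxab.trans (hκ b hb v hv huv x hx hxD.2))
      · exact (hκ u hu b hb huv x hx hxD.2).trans
          (hxab.symm.trans (hκ a ha v hv h2.symm x hx hxD.2))
      · exact hκ u hu v hv huv x hx hxD.2
    · have hsub : T.image (fun u => if κ u = κ a then κ b else κ u) ⊆ (T.image κ).erase (κ a) := by
        intro y hy
        obtain ⟨u, hu, rfl⟩ := Finset.mem_image.1 hy
        rw [Finset.mem_erase]
        by_cases h1 : κ u = κ a
        · simp only [h1, if_true]
          exact ⟨hκab.symm, Finset.mem_image_of_mem κ hb⟩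
        · simp only [h1, if_false]
          exact ⟨h1, Finset.mem_image_of_mem κ hu⟩
      have h1 := Finset.card_le_card hsub
      have h2 := Finset.card_erase_add_one (Finset.mem_image_of_mem κ ha)
      rw [Finset.card_insert_of_notMem hs]
      omega

theorem exists_isAdjResolved_max (G : SimpleGraph V) (W : Finset V) :
    ∃ T, G.IsAdjResolved W T ∧ ∀ T', G.IsAdjResolved W T' → T'.card ≤ T.card := by
  classical
  obtain ⟨T, hT, hmax⟩ := Finset.exists_max_image (W.powerset.filter (G.IsAdjResolved W))
    Finset.card ⟨∅, by simp [IsAdjResolved]⟩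
  exact ⟨T, (Finset.mem_filter.1 hT).2, fun T' hT' =>
    hmax T' (Finset.mem_filter.2 ⟨Finset.mem_powerset.2 hT'.1, hT'⟩)⟩

/-- Dichotomy for a vertex outside a maximum adjacency-resolved set. -/
theorem exists_twin_or_exists_unique_separator {T : Finset V} (hT : G.IsAdjResolved W T)
    (hmax : ∀ T', G.IsAdjResolved W T' → T'.card ≤ T.card) {s : V} (hs : s ∈ W \ T) :
    (∃ t ∈ T, G.Adj s t ∧ ∀ x ∈ W \ T, x ≠ s → (G.Adj x s ↔ G.Adj x t)) ∨
      ∃ a ∈ T, ∃ b ∈ T, ¬(G.Adj s a ↔ G.Adj s b) ∧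
        ∀ x ∈ W \ T, x ≠ s → (G.Adj x a ↔ G.Adj x b) := by
  obtain ⟨hsW, hsT⟩ := Finset.mem_sdiff.1 hs
  have hnot : ¬G.IsAdjResolved W (insert s T) := fun h => by
    have := hmax _ h
    rw [Finset.card_insert_of_notMem hsT] at this
    omega
  have hex : ∃ u ∈ insert s T, ∃ v ∈ insert s T, G.Adj u v ∧
      ∀ w ∈ W \ insert s T, (G.Adj w u ↔ G.Adj w v) := by
    by_contra! hcon
    exact hnot ⟨Finset.insert_subset hsW hT.1, fun u hu v hv huv => by
      obtain ⟨w, hw, h⟩ := hcon u hu v hv huv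
      exact ⟨w, hw, by tauto⟩⟩
  obtain ⟨u, hu, v, hv, huv, hw⟩ := hex
  have hw' : ∀ x ∈ W \ T, x ≠ s → (G.Adj x u ↔ G.Adj x v) := fun x hx hxs =>
    hw x (by simp only [Finset.mem_sdiff, Finset.mem_insert] at hx ⊢; tauto)
  rcases Finset.mem_insert.1 hu with rfl | huT
  · exact Or.inl ⟨v, (Finset.mem_insert.1 hv).resolve_left huv.ne', huv, hw'⟩
  rcases Finset.mem_insert.1 hv with rfl | hvT
  · exact Or.inl ⟨u, huT, huv.symm, fun x hx hxs => (hw' x hx hxs).symm⟩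
  refine Or.inr ⟨u, huT, v, hvT, fun hiff => ?_, hw'⟩
  obtain ⟨w, hwm, hne⟩ := hT.2 u huT v hvT huv
  by_cases hws : w = s
  · exact hne (hws ▸ hiff)
  · exact hne (hw' w hwm hws)

/-- For a maximum T, let A be the vertices of S having a twin in T, D the other vertices of S, and c
the number of classes after merging. Then |D| ≤ |T| − c. The vertices of A with twin in a given
class form, with any member of that class, a clique, so |A| ≤ (k − 1)c. Hence |S| ≤ |T| + (k − 2)c ≤
(k − 1)|T|. -/
theorem hasLargeAdjResolved_of_forall_not_isNClique (hk : 2 ≤ k)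
    (hW : ∀ K ⊆ W, ¬G.IsNClique (k + 1) K) : G.HasLargeAdjResolved k W := by
  classical
  obtain ⟨T, hT, hmax⟩ := G.exists_isAdjResolved_max W
  refine ⟨T, hT, ?_⟩
  set S := W \ T with hS
  let IsTwin : V → V → Prop := fun s t =>
    t ∈ T ∧ G.Adj s t ∧ ∀ x ∈ S, x ≠ s → (G.Adj x s ↔ G.Adj x t)
  set A := S.filter (fun s => ∃ t, IsTwin s t) with hA
  set D := S.filter (fun s => ¬∃ t, IsTwin s t) with hD
  have hcard : A.card + D.card = S.card := Finset.card_filter_add_card_filter_not _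
  obtain ⟨κ, hκ, hκc⟩ := exists_merge_of_unique_separators G (S := S) (T := T) (D := D)
    (Finset.filter_subset _ _) (by
      intro s hs
      obtain ⟨hsS, hs⟩ := Finset.mem_filter.1 hs
      rcases exists_twin_or_exists_unique_separator hT hmax hsS with ⟨t, ht⟩ | h
      · exact absurd ⟨t, ht⟩ hs
      · exact h)
  have hAmem : ∀ s ∈ A, s ∈ S ∧ s ∉ D ∧ ∃ t, IsTwin s t := by
    intro s hs
    obtain ⟨h1, h2⟩ := Finset.mem_filter.1 hs
    exact ⟨h1, fun h => (Finset.mem_filter.1 h).2 h2, h2⟩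
  have hch : ∀ s, ∃ t, s ∈ A → IsTwin s t := by
    intro s
    by_cases hs : s ∈ A
    · obtain ⟨t, ht⟩ := (hAmem s hs).2.2
      exact ⟨t, fun _ => ht⟩
    · exact ⟨s, fun h => absurd h hs⟩
  choose τ hτ using hch
  have hfib : A.card ≤ (k - 1) * (T.image κ).card := by
    refine Finset.card_le_mul_card_image_of_maps_to (f := fun s => κ (τ s))
      (fun s hs => Finset.mem_image_of_mem κ (hτ s hs).1) _ fun c hc => ?_
    obtain ⟨t, ht, rfl⟩ := Finset.mem_image.1 hc
    set B := A.filter (fun s => κ (τ s) = κ t) with hB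
    have hBmem : ∀ s ∈ B, s ∈ A ∧ κ (τ s) = κ t := fun s hs => Finset.mem_filter.1 hs
    have hadj : ∀ s ∈ B, ∀ t' ∈ T, κ t' = κ t → G.Adj s t' := by
      intro s hs t' ht' htt
      obtain ⟨hsA, hsκ⟩ := hBmem s hs
      exact (hκ (τ s) (hτ s hsA).1 t' ht' (hsκ.trans htt.symm) s (hAmem s hsA).1
        (hAmem s hsA).2.1).1 (hτ s hsA).2.1
    have hclique : G.IsNClique B.card B := by
      rw [isNClique_iff]
      refine ⟨fun s hs s' hs' hne => ?_, rfl⟩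
      have hsA := (hBmem s' hs').1
      exact ((hτ s' hsA).2.2 s (hAmem s (hBmem s hs).1).1 hne).2
        (hadj s hs (τ s') (hτ s' hsA).1 (hBmem s' hs').2)
    have hins : G.IsNClique (B.card + 1) (insert t B) :=
      hclique.insert fun s hs => (hadj s hs t ht rfl).symm
    have hsub : insert t B ⊆ W := by
      refine Finset.insert_subset (hT.1 ht) fun s hs => ?_
      exact (Finset.mem_sdiff.1 (hAmem s (hBmem s hs).1).1).1
    by_contra hlt
    obtain ⟨C, hC, hCc⟩ := Finset.exists_subset_card_eq (s := insert t B) (n := k + 1)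
      (by rw [hins.card_eq]; omega)
    exact hW C (hC.trans hsub) ⟨hins.isClique.subset (by exact_mod_cast hC), hCc⟩
  have hWc : S.card + T.card = W.card := Finset.card_sdiff_add_card_eq_card hT.1
  have hle : (T.image κ).card ≤ T.card := Finset.card_image_le
  obtain ⟨j, rfl⟩ := Nat.exists_eq_add_of_le hk
  have hj : 2 + j - 1 = j + 1 := by omega
  rw [hj] at hfib
  nlinarith [Nat.mul_le_mul_left j hle]

/-! ### Robust pairs around a clique -/

/-- If Z failed to separate p from a neighbour w, then Z, p and w would form a (k+2)-clique. -/
theorem isRobustPair_of_common_neighbors (hG : G.CliqueFree (k + 2)) (hZ : Z ⊆ W)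
    (hZc : G.IsNClique k Z) {p q : V} (hp : p ∈ W) (hq : q ∈ W)
    (hpZ : ∀ z ∈ Z, G.Adj p z) (hqZ : ∀ z ∈ Z, G.Adj q z) : G.IsRobustPair W {p, q} Z := by
  have key : ∀ r, (∀ z ∈ Z, G.Adj r z) → ∀ w, G.Adj r w → ∃ z ∈ Z, ¬(G.Adj z r ↔ G.Adj z w) := by
    intro r hr w hrw
    by_contra! h
    have h1 : G.IsNClique (k + 1) (insert w Z) :=
      hZc.insert fun z hz => ((h z hz).1 (hr z hz).symm).symm
    refine hG _ (h1.insert (a := r) fun z hz => ?_)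
    rcases Finset.mem_insert.1 hz with rfl | hz
    · exact hrw
    · exact hr z hz
  refine ⟨by simp [Finset.insert_subset_iff, hp, hq], hZ, ?_, ?_⟩
  · rw [Finset.disjoint_left]
    intro x hx hxZ
    simp only [Finset.mem_insert, Finset.mem_singleton] at hx
    rcases hx with rfl | rfl
    · exact (hpZ x hxZ).ne rfl
    · exact (hqZ x hxZ).ne rfl
  · intro x hx w _ _ hxw
    simp only [Finset.mem_insert, Finset.mem_singleton] at hx
    rcases hx with rfl | rfl
    · exact key x hpZ w hxw
    · exact key x hqZ w hxw

/-- A vertex `u` adjacent to `a` but not to `b` yields a robust pair inside `insert u K`, when no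
other outside vertex is adjacent to all but one vertex of the clique `K`. -/
theorem isRobustPair_of_separating_vertex {K : Finset V} (hK : K ⊆ W)
    (hKc : G.IsNClique (k + 1) K) {u a b : V} (hu : u ∈ W) (huK : u ∉ K) (ha : a ∈ K) (hb : b ∈ K)
    (hua : G.Adj u a) (hub : ¬G.Adj u b)
    (H : ∀ w ∈ W, w ∉ K → w ≠ u → ∀ c ∈ K, ∃ x ∈ K, x ≠ c ∧ ¬G.Adj w x) :
    G.IsRobustPair W {a, b} (insert u (K \ {a, b})) := by
  have hdif : ∀ w, w ∉ insert u (K \ {a, b}) → w ≠ a → w ≠ b → w ∉ K ∧ w ≠ u := by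
    intro w
    simp only [Finset.mem_insert, Finset.mem_sdiff, Finset.mem_singleton]
    tauto
  have key : ∀ p ∈ K, ∀ q ∈ K, ({a, b} : Finset V) = {p, q} → ∀ w ∈ W, w ∉ K → w ≠ u →
      G.Adj p w → ∃ z ∈ insert u (K \ {a, b}), ¬(G.Adj z p ↔ G.Adj z w) := by
    intro p hp q hq he w hw hwK hwu hpw
    obtain ⟨x, hx, hxq, hwx⟩ := H w hw hwK hwu q hq
    have hxp : x ≠ p := by rintro rfl; exact hwx hpw.symm
    refine ⟨x, Finset.mem_insert_of_mem ?_, fun h => hwx (h.1 ?_).symm⟩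
    · rw [he]; simp [hx, hxq, hxp]
    · exact hKc.isClique hx hp hxp
  refine ⟨?_, ?_, ?_, ?_⟩
  · simp [Finset.insert_subset_iff, hK ha, hK hb]
  · exact Finset.insert_subset hu (Finset.sdiff_subset.trans hK)
  · rw [Finset.disjoint_left]
    intro x hx hx'
    rcases Finset.mem_insert.1 hx' with rfl | hx'
    · simp only [Finset.mem_insert, Finset.mem_singleton] at hx
      rcases hx with rfl | rfl
      · exact huK ha
      · exact huK hb
    · exact (Finset.mem_sdiff.1 hx').2 hx
  · intro p hp w hw hwZ hpw
    simp only [Finset.mem_insert, Finset.mem_singleton] at hp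
    rcases hp with rfl | rfl
    · by_cases hwb : w = b
      · subst hwb
        exact ⟨u, Finset.mem_insert_self _ _, fun h => hub (h.1 hua)⟩
      · obtain ⟨h1, h2⟩ := hdif w hwZ hpw.ne' hwb
        exact key p ha b hb rfl w hw h1 h2 hpw
    · by_cases hwa : w = a
      · subst hwa
        exact ⟨u, Finset.mem_insert_self _ _, fun h => hub (h.2 hua)⟩
      · obtain ⟨h1, h2⟩ := hdif w hwZ hwa hpw.ne'
        exact key p hb a ha (Finset.pair_comm _ _) w hw h1 h2 hpw

/-- Since u is adjacent to some but not all of K, it separates two vertices of K. As u lands in the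
Z-part, leftover clique components attached to u can be absorbed. -/
theorem exists_isRobustPair_insert {K : Finset V} (hG : G.CliqueFree (k + 2)) (hK : K ⊆ W)
    (hKc : G.IsNClique (k + 1) K) {u : V} (hu : u ∈ W) (huK : u ∉ K) (hadj : ∃ a ∈ K, G.Adj u a)
    (H : ∀ w ∈ W, w ∉ K → w ≠ u → ∀ c ∈ K, ∃ x ∈ K, x ≠ c ∧ ¬G.Adj w x) :
    ∃ a ∈ K, ∃ b ∈ K, a ≠ b ∧ G.IsRobustPair W {a, b} (insert u (K \ {a, b})) ∧
      (insert u (K \ {a, b})).card = k ∧ {a, b} ∪ insert u (K \ {a, b}) = insert u K := by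
  obtain ⟨a, ha, hua⟩ := hadj
  obtain ⟨b, hb, hub⟩ := exists_not_adj_of_cliqueFree hG hKc u
  have hne : a ≠ b := by rintro rfl; exact hub hua
  have hsub : ({a, b} : Finset V) ⊆ K := by simp [Finset.insert_subset_iff, ha, hb]
  refine ⟨a, ha, b, hb, hne, isRobustPair_of_separating_vertex hK hKc hu huK ha hb hua hub H,
    ?_, ?_⟩
  · rw [Finset.card_insert_of_notMem fun h => huK (Finset.sdiff_subset h),
      Finset.card_sdiff_of_subset hsub, hKc.card_eq, Finset.card_pair hne]
    have := Finset.card_le_card hsub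
    rw [Finset.card_pair hne, hKc.card_eq] at this
    omega
  · rw [Finset.union_insert, Finset.union_sdiff_of_subset hsub]

theorem IsRobustPair.hasLargeAdjResolved_of_pair (hk : 2 ≤ k) (hG : G.CliqueFree (k + 2))
    (IH : ∀ W' ⊂ W, (∀ L, ¬G.IsCliqueComponent (k + 1) W' L) → G.HasLargeAdjResolved k W')
    {a b : V} (hab : a ≠ b) (h : G.IsRobustPair W {a, b} Z) (hZ : Z.card = k)
    (hadj : ∀ L, G.IsCliqueComponent (k + 1) (W \ ({a, b} ∪ Z)) L →
      ∃ l ∈ L, ∃ z ∈ Z, G.Adj l z) : G.HasLargeAdjResolved k W := by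
  refine h.hasLargeAdjResolved hG IH (Finset.insert_nonempty _ _) ?_ hadj
  -- The inequality becomes k + 2 ≤ 2k, which needs `2 ≤ k`.
  rw [hZ, Finset.card_pair hab]
  omega

/-! ### Clique components behind one or two vertices -/

theorem exists_mem_ne (hk : 2 ≤ k) (hLc : G.IsNClique (k + 1) L) (a b : V) :
    ∃ x ∈ L, x ≠ a ∧ x ≠ b := by
  by_contra! h
  have hsub : L ⊆ {a, b} := fun x hx => by
    by_cases hxa : x = a
    · simp [hxa]
    · simp [h x hx hxa]
  have := (Finset.card_le_card hsub).trans Finset.card_le_two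
  rw [hLc.card_eq] at this
  omega

/-- The case of a clique component hanging off a single vertex. -/
theorem hasLargeAdjResolved_of_isCliqueComponent_sdiff_singleton (hk : 2 ≤ k)
    (hG : G.CliqueFree (k + 2))
    (IH : ∀ W' ⊂ W, (∀ L, ¬G.IsCliqueComponent (k + 1) W' L) → G.HasLargeAdjResolved k W')
    (hW : ∀ L, ¬G.IsCliqueComponent (k + 1) W L) {p : V} (hp : p ∈ W)
    (hL : G.IsCliqueComponent (k + 1) (W \ {p}) L) : G.HasLargeAdjResolved k W := by
  have hattach : ∀ M, G.IsCliqueComponent (k + 1) (W \ {p}) M → ∃ a ∈ M, G.Adj p a := by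
    intro M hM
    obtain ⟨a, ha, b, hb, hbM, hab⟩ :=
      exists_adj_of_not_isCliqueComponent hW (hM.1.trans Finset.sdiff_subset) hM.2.1
    have hbp : b = p := by
      by_contra hbp
      exact hM.2.2 a ha b (by simp [hb, hbp]) hbM hab
    exact ⟨a, ha, hbp ▸ hab.symm⟩
  have hpL : p ∉ L := fun h => by simpa using hL.1 h
  obtain ⟨a, ha, b, hb, hne, hr, hc, hU⟩ := exists_isRobustPair_insert hG
    (hL.1.trans Finset.sdiff_subset) hL.2.1 hp hpL (hattach L hL) (by
      intro w hw hwL hwp c _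
      obtain ⟨x, hx, hxc, -⟩ := exists_mem_ne hk hL.2.1 c c
      exact ⟨x, hx, hxc, fun h => hL.2.2 x hx w (by simp [hw, hwp]) hwL h.symm⟩)
  refine hr.hasLargeAdjResolved_of_pair hk hG IH hne hc fun M hM => ?_
  rw [hU] at hM
  -- M is also a component of W \ {p}, hence attached to p, which lies in the Z-part.
  obtain ⟨m, hm, hpm⟩ := hattach M ⟨hM.1.trans (Finset.sdiff_subset_sdiff le_rfl (by simp)),
    hM.2.1, by
      intro x hx y hy hyM hxy
      by_cases hyL : y ∈ L
      · have := Finset.mem_sdiff.1 (hM.1 hx)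
        rw [Finset.mem_insert, not_or] at this
        exact hL.2.2 y hyL x (by simp [this]) this.2.2 hxy.symm
      · rw [Finset.mem_sdiff, Finset.mem_singleton] at hy
        exact hM.2.2 x hx y (by simp [hy, hyL]) hyM hxy⟩
  exact ⟨m, hm, p, Finset.mem_insert_self _ _, hpm.symm⟩

/-- A clique component `L` of `W \ {p, q}`, where `insert p L` carries a robust pair and `p`, `q`
have a common neighbour outside `L`. -/
theorem IsRobustPair.hasLargeAdjResolved_of_insert (hk : 2 ≤ k) (hG : G.CliqueFree (k + 2))
    (IH : ∀ W' ⊂ W, (∀ L, ¬G.IsCliqueComponent (k + 1) W' L) → G.HasLargeAdjResolved k W')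
    (hW : ∀ L, ¬G.IsCliqueComponent (k + 1) W L) {p q z : V} (hp : p ∈ W)
    (hL : G.IsCliqueComponent (k + 1) (W \ {p, q}) L) (hpL : ∃ a ∈ L, G.Adj p a)
    (hz : z ∈ W) (hzL : z ∉ L) (hzp : G.Adj p z) (hzq : G.Adj q z)
    {a b : V} (hab : a ≠ b) (h : G.IsRobustPair W {a, b} Z) (hZ : Z.card = k)
    (hU : {a, b} ∪ Z = insert p L) : G.HasLargeAdjResolved k W := by
  by_cases hbad : ∀ M, G.IsCliqueComponent (k + 1) (W \ ({a, b} ∪ Z)) M →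
      ∃ m ∈ M, ∃ z ∈ Z, G.Adj m z
  · exact h.hasLargeAdjResolved_of_pair hk hG IH hab hZ hbad
  push Not at hbad
  obtain ⟨K, hK, -⟩ := hbad
  rw [hU] at hK
  have hKmem : ∀ x ∈ K, x ∈ W ∧ x ≠ p ∧ x ∉ L := by
    intro x hx
    have := hK.1 hx
    simpa [not_or] using this
  have hLmem : ∀ x ∈ L, x ∈ W ∧ x ≠ p ∧ x ≠ q := by
    intro x hx
    have := hL.1 hx
    simpa [not_or] using this
  have hLout : ∀ l ∈ L, ∀ w ∈ W, w ∉ L → w ≠ p → G.Adj l w → w = q := by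
    intro l hl w hw hwL hwp hlw
    by_contra hwq
    exact hL.2.2 l hl w (by simp [hw, hwp, hwq]) hwL hlw
  have hKout : ∀ x ∈ K, ∀ w ∈ W, w ∉ K → w ≠ p → w ∉ L → ¬G.Adj x w := by
    intro x hx w hw hwK hwp hwL
    exact hK.2.2 x hx w (by simp [hw, hwp, hwL]) hwK
  -- Vertices of L have no neighbours outside L except p and q. So if q ∉ K, the clique K hangs off
  -- p alone.
  by_cases hqK : q ∈ K
  swap
  · refine hasLargeAdjResolved_of_isCliqueComponent_sdiff_singleton hk hG IH hW hp (L := K)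
      ⟨fun x hx => by simp [hKmem x hx], hK.2.1, ?_⟩
    intro x hx y hy hyK hxy
    rw [Finset.mem_sdiff, Finset.mem_singleton] at hy
    by_cases hyL : y ∈ L
    · have := hLout y hyL x (hKmem x hx).1 (hKmem x hx).2.2 (hKmem x hx).2.1 hxy.symm
      exact hqK (this ▸ hx)
    · exact hKout x hx y hy.1 hyK hy.2 hyL hxy
  have hzK : z ∈ K := by
    by_contra hzK
    exact hKout q hqK z hz hzK hzp.ne' hzL hzq
  have hpK : p ∉ K := fun h => (hKmem p h).2.1 rfl
  -- Now z ∈ K, so p is adjacent to K; restart with a pair inside `insert p K`. Other outside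
  -- vertices can meet K only in q.
  obtain ⟨c, hc, d, hd, hcd, hr, hcard, hU'⟩ := exists_isRobustPair_insert hG
    (fun x hx => (hKmem x hx).1) hK.2.1 hp hpK ⟨z, hzK, hzp⟩ (by
      intro w hw hwK hwp e _
      obtain ⟨x, hx, hxe, hxq⟩ := exists_mem_ne hk hK.2.1 e q
      refine ⟨x, hx, hxe, fun hwx => ?_⟩
      by_cases hwL : w ∈ L
      · exact hxq (hLout w hwL x (hKmem x hx).1 (hKmem x hx).2.2 (hKmem x hx).2.1 hwx)
      · exact hKout x hx w hw hwK hwp hwL hwx.symm)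
  refine hr.hasLargeAdjResolved_of_pair hk hG IH hcd hcard fun M hM => ?_
  rw [hU'] at hM
  have hMmem : ∀ x ∈ M, x ∈ W ∧ x ≠ p ∧ x ∉ K := by
    intro x hx
    have := hM.1 hx
    simpa [not_or] using this
  suffices ∃ m ∈ M, G.Adj m p by
    obtain ⟨m, hm, hmp⟩ := this
    exact ⟨m, hm, p, Finset.mem_insert_self _ _, hmp⟩
  obtain ⟨m, hm, y, hy, hyM, hmy⟩ :=
    exists_adj_of_not_isCliqueComponent hW (fun x hx => (hMmem x hx).1) hM.2.1
  by_cases hyp : y = p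
  · exact ⟨m, hm, hyp ▸ hmy⟩
  have hyK : y ∈ K := by
    by_contra hyK
    exact hM.2.2 m hm y (by simp [hy, hyp, hyK]) hyM hmy
  -- Besides p, only L can reach K. Hence M meets L, so it contains L and with it a neighbour of p.
  have hmL : m ∈ L := by
    by_contra hmL
    exact hKout y hyK m (hMmem m hm).1 (hMmem m hm).2.2 (hMmem m hm).2.1 hmL hmy.symm
  obtain ⟨l, hl, hpl⟩ := hpL
  refine ⟨l, ?_, hpl.symm⟩
  by_contra hlM
  refine hM.2.2 m hm l ?_ hlM (hL.2.1.isClique hmL hl fun he => hlM (he ▸ hm))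
  simp only [Finset.mem_sdiff, Finset.mem_insert, not_or]
  exact ⟨(hLmem l hl).1, (hLmem l hl).2.1, fun h => (hKmem l h).2.2 hl⟩

/-- The case of a clique component hanging off two vertices with a common neighbour. -/
theorem hasLargeAdjResolved_of_isCliqueComponent_sdiff_pair (hk : 2 ≤ k)
    (hG : G.CliqueFree (k + 2))
    (IH : ∀ W' ⊂ W, (∀ L, ¬G.IsCliqueComponent (k + 1) W' L) → G.HasLargeAdjResolved k W')
    (hW : ∀ L, ¬G.IsCliqueComponent (k + 1) W L) {p q z : V} (hp : p ∈ W) (hq : q ∈ W)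
    (hL : G.IsCliqueComponent (k + 1) (W \ {p, q}) L)
    (hz : z ∈ W) (hzL : z ∉ L) (hzp : G.Adj p z) (hzq : G.Adj q z) :
    G.HasLargeAdjResolved k W := by
  have hLmem : ∀ x ∈ L, x ∈ W ∧ x ≠ p ∧ x ≠ q := by
    intro x hx
    have := hL.1 hx
    simpa [not_or] using this
  have hLout : ∀ l ∈ L, ∀ w ∈ W, w ∉ L → G.Adj l w → w = p ∨ w = q := by
    intro l hl w hw hwL hlw
    by_contra! hwq
    exact hL.2.2 l hl w (by simp [hw, hwq]) hwL hlw
  have hpL : p ∉ L := fun h => (hLmem p h).2.1 rfl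
  have hqL : q ∉ L := fun h => (hLmem q h).2.2 rfl
  by_cases hpa : ∃ a ∈ L, G.Adj p a
  swap
  · refine hasLargeAdjResolved_of_isCliqueComponent_sdiff_singleton hk hG IH hW hq (L := L)
      ⟨fun x hx => by simp [hLmem x hx], hL.2.1, fun x hx y hy hyL hxy => ?_⟩
    rw [Finset.mem_sdiff, Finset.mem_singleton] at hy
    rcases hLout x hx y hy.1 hyL hxy with rfl | rfl
    · exact hpa ⟨x, hx, hxy.symm⟩
    · exact hy.2 rfl
  by_cases hqa : ∃ a ∈ L, G.Adj q a
  swap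
  · refine hasLargeAdjResolved_of_isCliqueComponent_sdiff_singleton hk hG IH hW hp (L := L)
      ⟨fun x hx => by simp [hLmem x hx], hL.2.1, fun x hx y hy hyL hxy => ?_⟩
    rw [Finset.mem_sdiff, Finset.mem_singleton] at hy
    rcases hLout x hx y hy.1 hyL hxy with rfl | rfl
    · exact hy.2 rfl
    · exact hqa ⟨x, hx, hxy.symm⟩
  have key : ∀ r ∈ W, r ∉ L → ∀ c ∈ L, (∀ x ∈ L, x ≠ c → G.Adj r x) →
      r ≠ c ∧ G.IsRobustPair W {r, c} (L.erase c) ∧ (L.erase c).card = k ∧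
        {r, c} ∪ L.erase c = insert r L := by
    intro r hr hrL c hc hrc
    have hcard : (L.erase c).card = k := by
      rw [Finset.card_erase_of_mem hc, hL.2.1.card_eq]; rfl
    refine ⟨fun h => hrL (h ▸ hc), ?_, hcard, ?_⟩
    · refine isRobustPair_of_common_neighbors hG
        ((Finset.erase_subset _ _).trans fun x hx => (hLmem x hx).1)
        ⟨hL.2.1.isClique.subset (by simp), hcard⟩ hr (hLmem c hc).1 ?_ ?_
      · intro x hx
        exact hrc x (Finset.mem_of_mem_erase hx) (Finset.ne_of_mem_erase hx)
      · intro x hx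
        exact hL.2.1.isClique hc (Finset.mem_of_mem_erase hx) (Finset.ne_of_mem_erase hx).symm
    · rw [Finset.insert_union, Finset.singleton_union, Finset.insert_erase hc]
  -- If p (or q) is adjacent to all of L but possibly c, it shares the k-clique L \ {c} with c as
  -- common neighbours.
  by_cases hpc : ∃ c ∈ L, ∀ x ∈ L, x ≠ c → G.Adj p x
  · obtain ⟨c, hc, hpc⟩ := hpc
    obtain ⟨hne, hr, hcard, hU⟩ := key p hp hpL c hc hpc
    exact hr.hasLargeAdjResolved_of_insert hk hG IH hW hp hL hpa hz hzL hzp hzq hne hcard hU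
  by_cases hqc : ∃ c ∈ L, ∀ x ∈ L, x ≠ c → G.Adj q x
  · obtain ⟨c, hc, hqc⟩ := hqc
    obtain ⟨hne, hr, hcard, hU⟩ := key q hq hqL c hc hqc
    rw [Finset.pair_comm] at hL
    exact hr.hasLargeAdjResolved_of_insert hk hG IH hW hq hL hqa hz hzL hzq hzp hne
      hcard hU
  -- Here q misses at least two vertices of L, so it does not obstruct a pair inside `insert p L`.
  obtain ⟨a, ha, b, hb, hne, hr, hcard, hU⟩ := exists_isRobustPair_insert hG
    (fun x hx => (hLmem x hx).1) hL.2.1 hp hpL hpa (by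
      intro w hw hwL hwp c hc
      by_contra! hcon
      obtain ⟨x, hx, hxc, -⟩ := exists_mem_ne hk hL.2.1 c c
      rcases hLout x hx w hw hwL (hcon x hx hxc).symm with rfl | rfl
      · exact hwp rfl
      · exact hqc ⟨c, hc, hcon⟩)
  exact hr.hasLargeAdjResolved_of_insert hk hG IH hW hp hL hpa hz hzL hzp hzq hne hcard hU

/-- A leftover clique component without neighbours in Z is a component of W \ {p, q}, so it hangs
off p and q, whose common neighbour z lies outside it. -/
theorem IsRobustPair.hasLargeAdjResolved_of_common_neighbor (hk : 2 ≤ k)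
    (hG : G.CliqueFree (k + 2))
    (IH : ∀ W' ⊂ W, (∀ L, ¬G.IsCliqueComponent (k + 1) W' L) → G.HasLargeAdjResolved k W')
    (hW : ∀ L, ¬G.IsCliqueComponent (k + 1) W L) {p q z : V} (hpq : p ≠ q)
    (h : G.IsRobustPair W {p, q} Z) (hZ : Z.card = k) (hz : z ∈ Z) (hzp : G.Adj p z)
    (hzq : G.Adj q z) : G.HasLargeAdjResolved k W := by
  by_cases hbad : ∀ M, G.IsCliqueComponent (k + 1) (W \ ({p, q} ∪ Z)) M →
      ∃ m ∈ M, ∃ z ∈ Z, G.Adj m z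
  · exact h.hasLargeAdjResolved_of_pair hk hG IH hpq hZ hbad
  push Not at hbad
  obtain ⟨L, hL, hLZ⟩ := hbad
  refine hasLargeAdjResolved_of_isCliqueComponent_sdiff_pair hk hG IH hW (h.1 (by simp))
    (h.1 (by simp)) (L := L) (z := z) ⟨?_, hL.2.1, ?_⟩ (h.2.1 hz) ?_ hzp hzq
  · exact hL.1.trans (Finset.sdiff_subset_sdiff le_rfl Finset.subset_union_left)
  · intro x hx y hy hyL hxy
    by_cases hyZ : y ∈ Z
    · exact hLZ x hx y hyZ hxy
    · refine hL.2.2 x hx y ?_ hyL hxy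
      rw [Finset.mem_sdiff] at hy ⊢
      exact ⟨hy.1, by rw [Finset.mem_union, not_or]; exact ⟨hy.2, hyZ⟩⟩
  · intro hzL
    have := hL.1 hzL
    simp [hz] at this

/-! ### The induction and the passage to distances -/

/-- In a graph without cliques on `k + 2` vertices, a vertex set without `(k + 1)`-clique
components has an adjacency-resolved subset of at least a `1 / k` fraction of its size. -/
theorem hasLargeAdjResolved_of_cliqueFree (hk : 2 ≤ k) (hG : G.CliqueFree (k + 2)) (W : Finset V)
    (hW : ∀ L, ¬G.IsCliqueComponent (k + 1) W L) : G.HasLargeAdjResolved k W := by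
  induction W using Finset.strongInduction with
  | H W IH =>
    by_cases hK : ∀ K ⊆ W, ¬G.IsNClique (k + 1) K
    · exact hasLargeAdjResolved_of_forall_not_isNClique hk hK
    push Not at hK
    obtain ⟨K, hKW, hK⟩ := hK
    by_cases hZ : ∃ Z ⊆ W, G.IsNClique k Z ∧ ∃ p ∈ W, ∃ q ∈ W, p ≠ q ∧
        (∀ z ∈ Z, G.Adj p z) ∧ ∀ z ∈ Z, G.Adj q z
    · obtain ⟨Z, hZW, hZc, p, hp, q, hq, hpq, hpZ, hqZ⟩ := hZ
      obtain ⟨z, hz⟩ : Z.Nonempty := by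
        rw [← Finset.card_pos, hZc.card_eq]; omega
      exact (isRobustPair_of_common_neighbors hG hZW hZc hp hq hpZ
        hqZ).hasLargeAdjResolved_of_common_neighbor hk hG IH hW hpq hZc.card_eq hz
        (hpZ z hz) (hqZ z hz)
    obtain ⟨a, ha, u, hu, huK, hau⟩ := exists_adj_of_not_isCliqueComponent hW hKW hK
    obtain ⟨b, hb, c, hc, hbc, hr, hcard, -⟩ := exists_isRobustPair_insert hG hKW hK hu huK
      ⟨a, ha, hau.symm⟩ (by
        intro w hw hwK _ c hc
        -- Otherwise w and c would both be joined to the whole k-clique K \ {c}, the case already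
        -- settled.
        by_contra! hcon
        refine hZ ⟨K.erase c, (Finset.erase_subset _ _).trans hKW,
          ⟨hK.isClique.subset (by simp), by rw [Finset.card_erase_of_mem hc, hK.card_eq]; rfl⟩,
          w, hw, c, hKW hc, fun h => hwK (h ▸ hc), ?_, ?_⟩
        · intro x hx
          exact hcon x (Finset.mem_of_mem_erase hx) (Finset.ne_of_mem_erase hx)
        · intro x hx
          exact hK.isClique hc (Finset.mem_of_mem_erase hx) (Finset.ne_of_mem_erase hx).symm)
    obtain ⟨x, hx, hxb, hxc⟩ := exists_mem_ne hk hK b c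
    exact hr.hasLargeAdjResolved_of_common_neighbor hk hG IH hW hbc hcard (z := x)
      (by simp [hx, hxb, hxc]) (hK.isClique hb hx hxb.symm) (hK.isClique hc hx hxc.symm)

/-- Vertices equidistant from w are both adjacent to w or both not, adjacency being distance 1. -/
theorem isLocalResolvingSet_compl [Fintype V] {T : Finset V}
    (hT : G.IsAdjResolved Finset.univ T) : G.IsLocalResolvingSet Tᶜ := by
  intro u v hu hv huv
  obtain ⟨w, hw, hne⟩ := hT.2 u (by simpa using hu) v (by simpa using hv) huv
  refine ⟨w, by simpa using hw, fun hd => hne ?_⟩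
  rw [G.adj_comm w u, G.adj_comm w v, ← dist_eq_one_iff_adj, ← dist_eq_one_iff_adj, hd]

end SimpleGraph

theorem mainTheorem2 {V : Type*} [Fintype V] (G : SimpleGraph V) (hconn : G.Connected)
    (hn : G.cliqueNum + 1 ≤ Fintype.card V) (hω : 4 ≤ G.cliqueNum + 1) :
    (G.localMetricDim : ℤ) ≤
      ⌊(((G.cliqueNum : ℝ) - 2) / ((G.cliqueNum : ℝ) - 1)) * (Fintype.card V : ℝ)⌋ := by
  classical
  obtain ⟨k, hk⟩ : ∃ k, G.cliqueNum = k + 1 := ⟨G.cliqueNum - 1, by omega⟩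
  rw [hk] at hn hω ⊢
  have hG : G.CliqueFree (k + 2) := by
    intro s hs
    have := hs.isClique.card_le_cliqueNum
    rw [hs.card_eq, hk] at this
    omega
  obtain ⟨T, hT, hTc⟩ := SimpleGraph.hasLargeAdjResolved_of_cliqueFree (by omega) hG Finset.univ
    (by
      rintro L ⟨-, hLc, hLout⟩
      have hne : ∃ b, b ∉ L := by
        by_contra! h
        rw [← Finset.eq_univ_iff_forall] at h
        have := hLc.card_eq
        rw [h, Finset.card_univ] at this
        omega
      obtain ⟨b, hb⟩ := hne
      obtain ⟨a, ha⟩ : L.Nonempty := by rw [← Finset.card_pos, hLc.card_eq]; omega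
      obtain ⟨w⟩ := hconn.preconnected a b
      obtain ⟨d, -, hd1, hd2⟩ := w.exists_boundary_dart (L : Set V) ha hb
      exact hLout d.fst hd1 d.snd (Finset.mem_univ _) hd2 d.adj)
  have hdim : G.localMetricDim ≤ Tᶜ.card :=
    Nat.sInf_le ⟨Tᶜ, SimpleGraph.isLocalResolvingSet_compl hT, rfl⟩
  rw [Finset.card_univ] at hTc
  have hsum := Finset.card_compl_add_card T
  have hk0 : (0 : ℝ) < k := by exact_mod_cast (by omega : 0 < k)
  rw [Int.le_floor]
  have e1 : (G.localMetricDim : ℝ) + T.card ≤ Fintype.card V := by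
    exact_mod_cast (by omega : G.localMetricDim + T.card ≤ Fintype.card V)
  have e2 : (Fintype.card V : ℝ) ≤ k * T.card := by exact_mod_cast hTc
  push_cast
  rw [show (k : ℝ) + 1 - 2 = k - 1 by ring, show (k : ℝ) + 1 - 1 = k by ring, div_mul_eq_mul_div,
    le_div_iff₀ hk0]
  nlinarith
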